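/- Let $N\ge 2$, let $\Omega\subset\mathbb{R}^N$ be a bounded smooth domain, and let $0<s<1<p<\infty$ and $\alpha>0$. Let $\omega\in L^1(\Omega)\setminus\{0\}$ with $\omega\ge 0$, and put $\omega_n:=\min\{\omega,n\}$ for $n\in\mathbb{N}=\{1,2,\dots\}$. For measurable $u:\mathbb{R}^N\to\mathbb{R}$ let $$[u]_{s,p}:=\Big(\iint_{\mathbb{R}^{2N}}\frac{|u(x)-u(y)|^p}{|x-y|^{N+sp}}\,dx\,dy\Big)^{1/p},$$ and let $$W_0^{s,p}(\Omega):=\{u\in L^p(\mathbb{R}^N):\ [u]_{s,p}<\infty \text{ and } u=0 \text{ a.e. in } \mathbb{R}^N\setminus\Omega\}.$$ For every $n\in\mathbb{N}$ let $u_n\in W_0^{s,p}(\Omega)$ be the weak solution of $$(-\Delta_p)^s u_n=\frac{\omega_n}{(u_n+\frac1n)^{\alpha}}\ \text{ in }\Omega,\qquad u_n>0\ \text{ in }\Omega,\qquad u_n=0\ \text{ in }\mathbb{R}^N\setminus\Omega,$$ that is, $u_n>0$ a.e. in $\Omega$ and, for all $\varphi\in W_0^{s,p}(\Omega)$, $$\iint_{\mathbb{R}^{2N}}\frac{|u_n(x)-u_n(y)|^{p-2}(u_n(x)-u_n(y))(\varphi(x)-\varphi(y))}{|x-y|^{N+sp}}\,dx\,dy=\int_\Omega\frac{\omega_n\,\varphi}{(u_n+\frac1n)^{\alpha}}\,dx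 .$$ Then the sequences $\{u_n\}_{n\in\mathbb{N}}$ and $\{[u_n]_{s,p}\}_{n\in\mathbb{N}}\subset(0,\infty)$ are nondecreasing: for all $n\in\mathbb{N}$, $$u_n\le u_{n+1}\ \text{ in }\Omega\qquad\text{and}\qquad [u_n]_{s,p}\le[u_{n+1}]_{s,p}.$$ Here the inequality $u_n\le u_{n+1}$ holds a.e. in $\Omega$, and at every point of $\Omega$ if $u_n$ and $u_{n+1}$ are continuous in $\Omega$. -/

import Mathlib

open MeasureTheory

noncomputable section

namespace FracSing

/-- A bounded smooth domain of `ℝ^N`: a bounded, connected (in particular nonempty) open set which,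
near each point of its boundary, is the sublevel set `{ρ < 0}` of a `C^∞` function `ρ` with
nonvanishing differential at that point. -/
structure IsBoundedSmoothDomain {N : ℕ} (Ω : Set (EuclideanSpace ℝ (Fin N))) : Prop where
  isOpen : IsOpen Ω
  isConnected : IsConnected Ω
  isBounded : Bornology.IsBounded Ω
  smooth_boundary : ∀ x ∈ frontier Ω, ∃ ρ : EuclideanSpace ℝ (Fin N) → ℝ,
    ContDiff ℝ ((⊤ : ℕ∞) : WithTop ℕ∞) ρ ∧ fderiv ℝ ρ x ≠ 0 ∧ ∀ᶠ y in nhds x, (y ∈ Ω ↔ ρ y < 0)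

/-- The Gagliardo seminorm
`[u]_{s,p} = (∬_{ℝ^{2N}} |u(x) - u(y)|^p / |x - y|^{N+sp} dx dy)^{1/p}`, with values in `[0,∞]`. -/
def gagliardo {N : ℕ} (s p : ℝ) (u : EuclideanSpace ℝ (Fin N) → ℝ) : ENNReal :=
  (∫⁻ z : EuclideanSpace ℝ (Fin N) × EuclideanSpace ℝ (Fin N),
    ENNReal.ofReal (|u z.1 - u z.2| ^ p / ‖z.1 - z.2‖ ^ ((N : ℝ) + s * p))) ^ (1 / p)

/-- The fractional Sobolev space
`W_0^{s,p}(Ω) = {u ∈ L^p(ℝ^N) : [u]_{s,p} < ∞ and u = 0 a.e. in ℝ^N ∖ Ω}`.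
Its elements are represented by functions, considered up to almost everywhere equality. -/
structure MemW0 {N : ℕ} (Ω : Set (EuclideanSpace ℝ (Fin N))) (s p : ℝ)
    (u : EuclideanSpace ℝ (Fin N) → ℝ) : Prop where
  memLp : MemLp u (ENNReal.ofReal p) volume
  gagliardo_lt_top : gagliardo s p u < ⊤
  eq_zero_outside : ∀ᵐ x ∂(volume : Measure (EuclideanSpace ℝ (Fin N))), x ∉ Ω → u x = 0

/-- The duality pairing `⟨(-Δ_p)^s u, v⟩ =
∬_{ℝ^{2N}} |u(x) - u(y)|^{p-2} (u(x) - u(y)) (v(x) - v(y)) / |x - y|^{N+sp} dx dy`. -/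
def pairing {N : ℕ} (s p : ℝ) (u v : EuclideanSpace ℝ (Fin N) → ℝ) : ℝ :=
  ∫ z : EuclideanSpace ℝ (Fin N) × EuclideanSpace ℝ (Fin N),
    |u z.1 - u z.2| ^ (p - 2) * (u z.1 - u z.2) * (v z.1 - v z.2)
      / ‖z.1 - z.2‖ ^ ((N : ℝ) + s * p)

/-- `u` is a weak solution of the `n`-th regularized problem
`(-Δ_p)^s u = ω_n / (u + 1/n)^α` in `Ω`, `u > 0` in `Ω`, `u = 0` in `ℝ^N ∖ Ω`,
where `ω_n = min {ω, n}`. -/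
structure IsWeakSolution {N : ℕ} (Ω : Set (EuclideanSpace ℝ (Fin N))) (s p α : ℝ)
    (ω : EuclideanSpace ℝ (Fin N) → ℝ) (n : ℕ) (u : EuclideanSpace ℝ (Fin N) → ℝ) : Prop where
  memW0 : MemW0 Ω s p u
  pos : ∀ᵐ x ∂(volume.restrict Ω), 0 < u x
  weak_eq : ∀ φ : EuclideanSpace ℝ (Fin N) → ℝ, MemW0 Ω s p φ →
    pairing s p u φ = ∫ x in Ω, min (ω x) (n : ℝ) * φ x / (u x + 1 / (n : ℝ)) ^ α

end FracSing

end

/-!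
The proof is a comparison argument. Write `J t = |t| ^ (p - 2) * t` for the strictly increasing
nonlinearity of the operator, and let `u = u n`, `v = u (n + 1)`.

*Monotonicity of the solutions.* Both equations are tested with `φ = max (u - v) 0`, which belongs
to `W_0^{s,p}(Ω)` (`MemW0.posPart_sub`). Where `φ > 0` the right-hand side of the equation for `u`
is at most that of the equation for `v`, so `pairing s p u φ ≤ pairing s p v φ`. On the other hand
the integrand of the difference of the two pairings is pointwise nonnegative, because `J` and
`t ↦ max t 0` are monotone. Hence it vanishes almost everywhere, and strict monotonicity of `J`
makes `φ x = φ y` for almost every `(x, y)`. Since `φ` vanishes on the complement of `Ω`, which has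
positive measure, `φ = 0` (`MemW0.ae_eq_zero_of_ae_eq`).

*Monotonicity of the seminorms.* Testing the equation for `u` with `u` and with `v ≥ u` gives
`[u]^p = pairing s p u u ≤ pairing s p u v`, and Young's inequality bounds the last term by
`(1 - 1 / p) [u]^p + (1 / p) [v]^p`.
-/

open MeasureTheory

namespace FracSing

/-! ### The nonlinearity `t ↦ |t| ^ (p - 2) * t` -/

lemma abs_rpow_sub_two_mul_of_nonneg {p t : ℝ} (hp : 1 < p) (ht : 0 ≤ t) :
    |t| ^ (p - 2) * t = t ^ (p - 1) := by
  rcases ht.eq_or_lt with rfl | ht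
  · rw [mul_zero, Real.zero_rpow (by linarith)]
  · rw [abs_of_pos ht, ← Real.rpow_add_one ht.ne']
    congr 1
    ring

lemma abs_abs_rpow_sub_two_mul {p : ℝ} (hp : 1 < p) (t : ℝ) :
    |(|t| ^ (p - 2) * t)| = |t| ^ (p - 1) := by
  rw [← abs_rpow_sub_two_mul_of_nonneg hp (abs_nonneg t), abs_abs, abs_mul,
    abs_of_nonneg (Real.rpow_nonneg (abs_nonneg t) _)]

lemma abs_rpow_sub_two_mul_mul_self {p : ℝ} (hp : 1 < p) (t : ℝ) :
    |t| ^ (p - 2) * t * t = |t| ^ p := by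
  rw [mul_assoc, ← abs_mul_abs_self t, ← mul_assoc]
  have h := abs_rpow_sub_two_mul_of_nonneg hp (abs_nonneg t)
  rw [abs_abs] at h
  rw [h, ← Real.rpow_add_one' (abs_nonneg t) (by linarith)]
  congr 1
  ring

lemma strictMono_abs_rpow_sub_two_mul {p : ℝ} (hp : 1 < p) :
    StrictMono fun t : ℝ => |t| ^ (p - 2) * t := by
  refine strictMono_of_odd_strictMonoOn_nonneg (fun t => by simp) ?_
  intro a ha b hb hab
  simp only [Set.mem_Ici] at ha hb
  simp only [abs_rpow_sub_two_mul_of_nonneg hp ha, abs_rpow_sub_two_mul_of_nonneg hp hb]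
  exact Real.rpow_lt_rpow ha hab (by linarith)

lemma abs_rpow_sub_two_mul_mul_le {p : ℝ} (hp : 1 < p) (t c : ℝ) :
    |t| ^ (p - 2) * t * c ≤ (1 - 1 / p) * |t| ^ p + 1 / p * |c| ^ p := by
  have hpq := Real.HolderConjugate.conjExponent hp
  have h := Real.young_inequality c (|t| ^ (p - 2) * t) hpq
  have hq : (1 : ℝ) / p.conjExponent = 1 - 1 / p := by
    have := hpq.inv_add_inv_eq_one
    rw [one_div, one_div]
    linarith
  have hpow : |(|t| ^ (p - 2) * t)| ^ p.conjExponent = |t| ^ p := by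
    rw [abs_abs_rpow_sub_two_mul hp, ← Real.rpow_mul (abs_nonneg t), Real.conjExponent,
      mul_div_cancel₀ _ (by linarith)]
  rw [hpow] at h
  calc |t| ^ (p - 2) * t * c = c * (|t| ^ (p - 2) * t) := by ring
    _ ≤ |c| ^ p / p + |t| ^ p / p.conjExponent := h
    _ = (1 - 1 / p) * |t| ^ p + 1 / p * |c| ^ p := by rw [← hq]; ring

lemma abs_abs_rpow_sub_two_mul_mul_le {p : ℝ} (hp : 1 < p) (t c : ℝ) :
    |(|t| ^ (p - 2) * t * c)| ≤ |t| ^ p + |c| ^ p := by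
  have h1 := abs_rpow_sub_two_mul_mul_le hp t c
  have h2 := abs_rpow_sub_two_mul_mul_le hp t (-c)
  rw [abs_neg, mul_neg] at h2
  have ht : 0 ≤ |t| ^ p := by positivity
  have hc : 0 ≤ |c| ^ p := by positivity
  have h3 : 0 ≤ 1 / p := by positivity
  have h4 : 1 / p ≤ 1 := by rw [div_le_one (by linarith)]; exact hp.le
  rw [abs_le]
  constructor <;> nlinarith

lemma abs_rpow_le_of_abs_le_add {p : ℝ} (hp : 1 < p) {a b c : ℝ} (h : |c| ≤ |a| + |b|) :
    |c| ^ p ≤ 2 ^ p * (|a| ^ p + |b| ^ p) := by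
  have key : ∀ m : ℝ, 0 ≤ m → |c| ≤ 2 * m → |c| ^ p ≤ 2 ^ p * m ^ p := fun m hm hcm => by
    rw [← Real.mul_rpow zero_le_two hm]
    exact Real.rpow_le_rpow (abs_nonneg c) hcm (by linarith)
  have ha : 0 ≤ |a| ^ p := by positivity
  have hb : 0 ≤ |b| ^ p := by positivity
  have h2 : (0 : ℝ) ≤ 2 ^ p := by positivity
  rcases le_total |a| |b| with hab | hab
  · nlinarith [key |b| (abs_nonneg b) (by linarith)]
  · nlinarith [key |a| (abs_nonneg a) (by linarith)]

/-- Monotonicity of the operator tested against a truncation: here `a = u x`, `b = u y`, `c = v x`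
and `d = v y`. -/
lemma mul_posPart_sub_nonneg {p : ℝ} (hp : 1 < p) (a b c d : ℝ) :
    0 ≤ (|a - b| ^ (p - 2) * (a - b) - |c - d| ^ (p - 2) * (c - d)) *
      (max (a - c) 0 - max (b - d) 0) := by
  have hJ := (strictMono_abs_rpow_sub_two_mul hp).monotone
  rcases le_total (a - b) (c - d) with h | h
  · exact mul_nonneg_of_nonpos_of_nonpos (sub_nonpos.2 (hJ h))
      (sub_nonpos.2 (max_le_max_right _ (by linarith)))
  · exact mul_nonneg (sub_nonneg.2 (hJ h)) (sub_nonneg.2 (max_le_max_right _ (by linarith)))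

lemma posPart_sub_eq_of_mul_eq_zero {p : ℝ} (hp : 1 < p) {a b c d : ℝ}
    (h : (|a - b| ^ (p - 2) * (a - b) - |c - d| ^ (p - 2) * (c - d)) *
      (max (a - c) 0 - max (b - d) 0) = 0) : max (a - c) 0 = max (b - d) 0 := by
  rcases mul_eq_zero.1 h with h | h
  · have h' : a - b = c - d := (strictMono_abs_rpow_sub_two_mul hp).injective (sub_eq_zero.1 h)
    rw [show a - c = b - d by linarith]
  · exact sub_eq_zero.1 h

/-! ### Integrability of the energy and of the pairing -/

variable {N : ℕ} {Ω : Set (EuclideanSpace ℝ (Fin N))} {s p : ℝ}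
  {u v φ : EuclideanSpace ℝ (Fin N) → ℝ}

lemma aestronglyMeasurable_sub_prod (hu : AEStronglyMeasurable u volume) :
    AEStronglyMeasurable (fun z : EuclideanSpace ℝ (Fin N) × EuclideanSpace ℝ (Fin N) =>
      u z.1 - u z.2) volume :=
  (hu.comp_quasiMeasurePreserving Measure.quasiMeasurePreserving_fst).sub
    (hu.comp_quasiMeasurePreserving Measure.quasiMeasurePreserving_snd)

lemma measurable_norm_sub_rpow (r : ℝ) :
    Measurable fun z : EuclideanSpace ℝ (Fin N) × EuclideanSpace ℝ (Fin N) =>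
      ‖z.1 - z.2‖ ^ r := by
  fun_prop

/-- The integrand of the `p`-th power of the Gagliardo seminorm. -/
noncomputable def energyDensity (s p : ℝ) (u : EuclideanSpace ℝ (Fin N) → ℝ)
    (z : EuclideanSpace ℝ (Fin N) × EuclideanSpace ℝ (Fin N)) : ℝ :=
  |u z.1 - u z.2| ^ p / ‖z.1 - z.2‖ ^ ((N : ℝ) + s * p)

lemma energyDensity_nonneg (z : EuclideanSpace ℝ (Fin N) × EuclideanSpace ℝ (Fin N)) :
    0 ≤ energyDensity s p u z := by
  unfold energyDensity
  positivity

lemma aestronglyMeasurable_energyDensity (hu : AEStronglyMeasurable u volume) :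
    AEStronglyMeasurable (energyDensity s p u) volume :=
  (((aestronglyMeasurable_sub_prod hu).aemeasurable.abs.pow_const p).div
    (measurable_norm_sub_rpow _).aemeasurable).aestronglyMeasurable

lemma gagliardo_eq_ofReal_integral (h : Integrable (energyDensity s p u) volume) :
    gagliardo s p u = ENNReal.ofReal (∫ z, energyDensity s p u z) ^ (1 / p) := by
  rw [ofReal_integral_eq_lintegral_ofReal h (.of_forall energyDensity_nonneg)]
  rfl

lemma MemW0.integrable_energyDensity (hp : 1 < p) (hu : MemW0 Ω s p u) :
    Integrable (energyDensity s p u) volume := by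
  have h := hu.gagliardo_lt_top
  rw [gagliardo, ENNReal.rpow_lt_top_iff_of_pos (by positivity)] at h
  exact ⟨aestronglyMeasurable_energyDensity hu.memLp.1,
    (hasFiniteIntegral_iff_ofReal (.of_forall energyDensity_nonneg)).2 h⟩

lemma MemW0.posPart_sub (hp : 1 < p) (hu : MemW0 Ω s p u) (hv : MemW0 Ω s p v) :
    MemW0 Ω s p fun x => max (u x - v x) 0 := by
  have hmem : MemLp (fun x => max (u x - v x) 0) (ENNReal.ofReal p) volume :=
    (hu.memLp.sub hv.memLp).pos_part
  refine ⟨hmem, ?_, ?_⟩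
  · have hint : Integrable (energyDensity s p fun x => max (u x - v x) 0) volume := by
      refine (((hu.integrable_energyDensity hp).add (hv.integrable_energyDensity hp)).const_mul
        (2 ^ p)).mono' (aestronglyMeasurable_energyDensity hmem.1) (.of_forall fun z => ?_)
      rw [Real.norm_of_nonneg (energyDensity_nonneg z)]
      simp only [energyDensity, Pi.add_apply]
      rw [← add_div, ← mul_div_assoc]
      refine div_le_div_of_nonneg_right (abs_rpow_le_of_abs_le_add hp ?_) (by positivity)
      calc |max (u z.1 - v z.1) 0 - max (u z.2 - v z.2) 0|
          ≤ |(u z.1 - v z.1) - (u z.2 - v z.2)| := abs_max_sub_max_le_abs _ _ _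
        _ = |(u z.1 - u z.2) - (v z.1 - v z.2)| := by ring_nf
        _ ≤ _ := abs_sub _ _
    rw [gagliardo_eq_ofReal_integral hint]
    exact ENNReal.rpow_lt_top_of_nonneg (by positivity) ENNReal.ofReal_ne_top
  · filter_upwards [hu.eq_zero_outside, hv.eq_zero_outside] with x h1 h2 hx
    simp [h1 hx, h2 hx]

/-- The integrand of the duality pairing. -/
noncomputable def pairingDensity (s p : ℝ) (u φ : EuclideanSpace ℝ (Fin N) → ℝ)
    (z : EuclideanSpace ℝ (Fin N) × EuclideanSpace ℝ (Fin N)) : ℝ :=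
  |u z.1 - u z.2| ^ (p - 2) * (u z.1 - u z.2) * (φ z.1 - φ z.2)
    / ‖z.1 - z.2‖ ^ ((N : ℝ) + s * p)

lemma pairing_eq_integral_pairingDensity :
    pairing s p u φ = ∫ z, pairingDensity s p u φ z := rfl

lemma integrable_pairingDensity (hp : 1 < p) (hu : MemW0 Ω s p u) (hφ : MemW0 Ω s p φ) :
    Integrable (pairingDensity s p u φ) volume := by
  have mu := (aestronglyMeasurable_sub_prod hu.memLp.1).aemeasurable
  have mφ := (aestronglyMeasurable_sub_prod hφ.memLp.1).aemeasurable
  refine ((hu.integrable_energyDensity hp).add (hφ.integrable_energyDensity hp)).mono'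
    ((((mu.abs.pow_const (p - 2)).mul mu).mul mφ).div
      (measurable_norm_sub_rpow _).aemeasurable).aestronglyMeasurable (.of_forall fun z => ?_)
  simp only [energyDensity, pairingDensity, Pi.add_apply]
  have hK : 0 ≤ ‖z.1 - z.2‖ ^ ((N : ℝ) + s * p) := by positivity
  rw [← add_div, Real.norm_eq_abs, abs_div, abs_of_nonneg hK]
  exact div_le_div_of_nonneg_right (abs_abs_rpow_sub_two_mul_mul_le hp _ _) hK

lemma pairing_self (hp : 1 < p) : pairing s p u u = ∫ z, energyDensity s p u z := by
  simp only [pairing, energyDensity, abs_rpow_sub_two_mul_mul_self hp]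

lemma pairing_le (hp : 1 < p) (hu : MemW0 Ω s p u) (hv : MemW0 Ω s p v) :
    pairing s p u v ≤
      (1 - 1 / p) * (∫ z, energyDensity s p u z) + 1 / p * ∫ z, energyDensity s p v z := by
  have iu := (hu.integrable_energyDensity hp).const_mul (1 - 1 / p)
  have iv := (hv.integrable_energyDensity hp).const_mul (1 / p)
  rw [pairing_eq_integral_pairingDensity, ← integral_const_mul, ← integral_const_mul,
    ← integral_add iu iv]
  refine integral_mono (integrable_pairingDensity hp hu hv) (iu.add iv) fun z => ?_
  simp only [energyDensity, pairingDensity]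
  rw [← mul_div_assoc, ← mul_div_assoc, ← add_div]
  exact div_le_div_of_nonneg_right (abs_rpow_sub_two_mul_mul_le hp _ _) (by positivity)

/-! ### Functions with vanishing differences -/

lemma volume_compl_ne_zero (hN : 2 ≤ N) (hΩ : Bornology.IsBounded Ω) : volume Ωᶜ ≠ 0 := by
  have : Nontrivial (EuclideanSpace ℝ (Fin N)) := by
    have : Nonempty (Fin N) := ⟨⟨0, by omega⟩⟩
    infer_instance
  intro h
  have htop : volume (Set.univ : Set (EuclideanSpace ℝ (Fin N))) = ⊤ :=
    measure_univ_of_isAddLeftInvariant _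
  rw [← Set.union_compl_self Ω] at htop
  have hle := measure_union_le (μ := volume) Ω Ωᶜ
  rw [htop, h, add_zero] at hle
  exact absurd hΩ.measure_lt_top (not_lt.2 hle)

/-- A function vanishing outside a bounded set and taking the same value at almost every pair of
points is zero: the constant is read off on the complement. -/
lemma MemW0.ae_eq_zero_of_ae_eq (hN : 2 ≤ N) (hΩ : Bornology.IsBounded Ω) (hφ : MemW0 Ω s p φ)
    (h : ∀ᵐ z : EuclideanSpace ℝ (Fin N) × EuclideanSpace ℝ (Fin N), φ z.1 = φ z.2) :
    ∀ᵐ x, φ x = 0 := by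
  have hprod : ∀ᵐ x : EuclideanSpace ℝ (Fin N), ∀ᵐ y : EuclideanSpace ℝ (Fin N), φ x = φ y :=
    Measure.ae_ae_of_ae_prod h
  filter_upwards [hprod] with x hx
  have hfreq : ∃ᵐ y : EuclideanSpace ℝ (Fin N), y ∈ Ωᶜ :=
    frequently_ae_mem_iff.2 (volume_compl_ne_zero hN hΩ)
  obtain ⟨y, hy, hxy, hy0⟩ := (hfreq.and_eventually (hx.and hφ.eq_zero_outside)).exists
  rw [hxy, hy0 hy]

/-! ### Comparison of weak solutions -/

variable {α : ℝ} {ω : EuclideanSpace ℝ (Fin N) → ℝ} {n m : ℕ}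

lemma integrable_rhs (hp : 1 < p) (hΩ : Bornology.IsBounded Ω) (hα : 0 < α) (hn : 1 ≤ n)
    (hω_int : IntegrableOn ω Ω volume) (hω_nonneg : ∀ᵐ x ∂(volume.restrict Ω), 0 ≤ ω x)
    (hu : MemW0 Ω s p u) (hpos : ∀ᵐ x ∂(volume.restrict Ω), 0 < u x) (hφ : MemW0 Ω s p φ) :
    Integrable (fun x => min (ω x) (n : ℝ) * φ x / (u x + 1 / (n : ℝ)) ^ α)
      (volume.restrict Ω) := by
  have : IsFiniteMeasure (volume.restrict Ω) := ⟨by simpa using hΩ.measure_lt_top⟩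
  have hn0 : (0 : ℝ) < n := by exact_mod_cast hn
  have iφ : Integrable φ (volume.restrict Ω) :=
    (hφ.memLp.restrict Ω).integrable (by simpa using hp.le)
  have mφ := iφ.aestronglyMeasurable.aemeasurable
  have mω := hω_int.aestronglyMeasurable.aemeasurable
  have mu := hu.memLp.1.aemeasurable.restrict (s := Ω)
  refine (iφ.norm.const_mul ((n : ℝ) / (1 / (n : ℝ)) ^ α)).mono'
    ((((mω.min aemeasurable_const).mul mφ).div
      ((mu.add_const _).pow_const α))).aestronglyMeasurable ?_
  filter_upwards [hω_nonneg, hpos] with x hω hx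
  have hbase : (0 : ℝ) < (1 / (n : ℝ)) ^ α := by positivity
  have hden : (1 / (n : ℝ)) ^ α ≤ (u x + 1 / (n : ℝ)) ^ α :=
    Real.rpow_le_rpow (by positivity) (by linarith) hα.le
  rw [norm_div, norm_mul, Real.norm_of_nonneg (le_min hω hn0.le),
    Real.norm_of_nonneg (hbase.le.trans hden), div_mul_eq_mul_div]
  exact div_le_div₀ (by positivity)
    (mul_le_mul_of_nonneg_right (min_le_right _ _) (norm_nonneg _)) hbase hden

/-- Weak comparison principle for the regularized problems: the right-hand side increases with the
index and decreases with the solution. -/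
lemma IsWeakSolution.ae_le (hN : 2 ≤ N) (hΩ : Bornology.IsBounded Ω) (hp : 1 < p) (hα : 0 < α)
    (hn : 1 ≤ n) (hnm : n ≤ m) (hω_int : IntegrableOn ω Ω volume)
    (hω_nonneg : ∀ᵐ x ∂(volume.restrict Ω), 0 ≤ ω x)
    (hu : IsWeakSolution Ω s p α ω n u) (hv : IsWeakSolution Ω s p α ω m v) :
    ∀ᵐ x, u x ≤ v x := by
  have hφ : MemW0 Ω s p fun x => max (u x - v x) 0 := hu.memW0.posPart_sub hp hv.memW0
  have hn0 : (0 : ℝ) < n := by exact_mod_cast hn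
  have hnm' : (n : ℝ) ≤ m := by exact_mod_cast hnm
  have hrhs : pairing s p u (fun x => max (u x - v x) 0) ≤
      pairing s p v fun x => max (u x - v x) 0 := by
    rw [hu.weak_eq _ hφ, hv.weak_eq _ hφ]
    refine integral_mono_ae
      (integrable_rhs hp hΩ hα hn hω_int hω_nonneg hu.memW0 hu.pos hφ)
      (integrable_rhs hp hΩ hα (hn.trans hnm) hω_int hω_nonneg hv.memW0 hv.pos hφ) ?_
    filter_upwards [hω_nonneg, hv.pos] with x hω hvx
    have hm0 : (0 : ℝ) < m := hn0.trans_le hnm'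
    rcases le_total (u x) (v x) with h | h
    · simp [max_eq_right (sub_nonpos.2 h)]
    · have hinv : 1 / (m : ℝ) ≤ 1 / (n : ℝ) := one_div_le_one_div_of_le hn0 hnm'
      have h1m : 0 < 1 / (m : ℝ) := by positivity
      exact div_le_div₀ (mul_nonneg (le_min hω hm0.le) (le_max_right _ _))
        (mul_le_mul_of_nonneg_right (min_le_min_left _ hnm') (le_max_right _ _))
        (Real.rpow_pos_of_pos (by linarith) _)
        (Real.rpow_le_rpow (by linarith) (by linarith) hα.le)
  have iu := integrable_pairingDensity hp hu.memW0 hφ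
  have iv := integrable_pairingDensity hp hv.memW0 hφ
  have hdiff : ∀ z : EuclideanSpace ℝ (Fin N) × EuclideanSpace ℝ (Fin N),
      pairingDensity s p u (fun x => max (u x - v x) 0) z -
        pairingDensity s p v (fun x => max (u x - v x) 0) z =
      (|u z.1 - u z.2| ^ (p - 2) * (u z.1 - u z.2) - |v z.1 - v z.2| ^ (p - 2) * (v z.1 - v z.2)) *
        (max (u z.1 - v z.1) 0 - max (u z.2 - v z.2) 0) / ‖z.1 - z.2‖ ^ ((N : ℝ) + s * p) := by
    intro z
    simp only [pairingDensity]
    rw [← sub_div, ← sub_mul]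
  have hnonneg : ∀ z : EuclideanSpace ℝ (Fin N) × EuclideanSpace ℝ (Fin N),
      0 ≤ pairingDensity s p u (fun x => max (u x - v x) 0) z -
        pairingDensity s p v (fun x => max (u x - v x) 0) z := fun z => by
    rw [hdiff]
    exact div_nonneg (mul_posPart_sub_nonneg hp _ _ _ _) (by positivity)
  have hzero : ∫ z, (pairingDensity s p u (fun x => max (u x - v x) 0) z -
      pairingDensity s p v (fun x => max (u x - v x) 0) z) = 0 := by
    refine le_antisymm ?_ (integral_nonneg hnonneg)
    rw [integral_sub iu iv]
    exact sub_nonpos.2 hrhs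
  have hae := (integral_eq_zero_iff_of_nonneg hnonneg (iu.sub iv)).1 hzero
  have heq : ∀ᵐ z : EuclideanSpace ℝ (Fin N) × EuclideanSpace ℝ (Fin N),
      max (u z.1 - v z.1) 0 = max (u z.2 - v z.2) 0 := by
    filter_upwards [hae] with z hz
    rw [hdiff z, Pi.zero_apply, div_eq_zero_iff] at hz
    rcases hz with hz | hz
    · exact posPart_sub_eq_of_mul_eq_zero hp hz
    -- The kernel is degenerate only on the diagonal, where the two values agree trivially.
    · rw [sub_eq_zero.1 (norm_eq_zero.1 (((Real.rpow_eq_zero_iff_of_nonneg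
        (norm_nonneg _)).1 hz).1))]
  filter_upwards [hφ.ae_eq_zero_of_ae_eq hN hΩ heq] with x hx
  exact sub_nonpos.1 (max_eq_right_iff.1 hx)

lemma IsWeakSolution.gagliardo_le (hp : 1 < p) (hΩ : Bornology.IsBounded Ω) (hα : 0 < α)
    (hn : 1 ≤ n) (hω_int : IntegrableOn ω Ω volume)
    (hω_nonneg : ∀ᵐ x ∂(volume.restrict Ω), 0 ≤ ω x)
    (hu : IsWeakSolution Ω s p α ω n u) (hv : MemW0 Ω s p v)
    (huv : ∀ᵐ x ∂(volume.restrict Ω), u x ≤ v x) : gagliardo s p u ≤ gagliardo s p v := by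
  have hle : pairing s p u u ≤ pairing s p u v := by
    rw [hu.weak_eq _ hu.memW0, hu.weak_eq _ hv]
    refine integral_mono_ae
      (integrable_rhs hp hΩ hα hn hω_int hω_nonneg hu.memW0 hu.pos hu.memW0)
      (integrable_rhs hp hΩ hα hn hω_int hω_nonneg hu.memW0 hu.pos hv) ?_
    filter_upwards [hω_nonneg, hu.pos, huv] with x hω hx hle
    exact div_le_div_of_nonneg_right
      (mul_le_mul_of_nonneg_left hle (le_min hω (Nat.cast_nonneg n))) (by positivity)
  have hyoung := hle.trans (pairing_le hp hu.memW0 hv)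
  rw [pairing_self hp] at hyoung
  have hp' : 0 < 1 / p := by positivity
  rw [gagliardo_eq_ofReal_integral (hu.memW0.integrable_energyDensity hp),
    gagliardo_eq_ofReal_integral (hv.integrable_energyDensity hp)]
  exact ENNReal.rpow_le_rpow (ENNReal.ofReal_le_ofReal
    (le_of_mul_le_mul_left (by linarith) hp')) hp'.le

lemma IsWeakSolution.gagliardo_pos (hN : 2 ≤ N) (hp : 1 < p) (hΩ : IsBoundedSmoothDomain Ω)
    (hu : IsWeakSolution Ω s p α ω n u) : 0 < gagliardo s p u := by
  rw [pos_iff_ne_zero]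
  intro h
  have hint := hu.memW0.integrable_energyDensity hp
  rw [gagliardo_eq_ofReal_integral hint, ENNReal.rpow_eq_zero_iff_of_pos (by positivity),
    ENNReal.ofReal_eq_zero] at h
  have hae := (integral_eq_zero_iff_of_nonneg energyDensity_nonneg hint).1
    (h.antisymm (integral_nonneg energyDensity_nonneg))
  have heq : ∀ᵐ z : EuclideanSpace ℝ (Fin N) × EuclideanSpace ℝ (Fin N), u z.1 = u z.2 := by
    filter_upwards [hae] with z hz
    rw [energyDensity, Pi.zero_apply, div_eq_zero_iff] at hz
    rcases hz with hz | hz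
    · exact sub_eq_zero.1 (abs_eq_zero.1 ((Real.rpow_eq_zero_iff_of_nonneg (abs_nonneg _)).1 hz).1)
    · rw [sub_eq_zero.1 (norm_eq_zero.1 (((Real.rpow_eq_zero_iff_of_nonneg
        (norm_nonneg _)).1 hz).1))]
  have hfreq : ∃ᵐ x : EuclideanSpace ℝ (Fin N), x ∈ Ω :=
    frequently_ae_mem_iff.2 (hΩ.isOpen.measure_pos volume hΩ.isConnected.nonempty).ne'
  obtain ⟨x, hx, hx0, hpos⟩ := (hfreq.and_eventually
    ((hu.memW0.ae_eq_zero_of_ae_eq hN hΩ.isBounded heq).and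
      (ae_imp_of_ae_restrict hu.pos))).exists
  exact (hpos hx).ne' hx0

lemma le_of_ae_le_of_continuousOn (hΩ : IsOpen Ω) (h : ∀ᵐ x, u x ≤ v x)
    (hu : ContinuousOn u Ω) (hv : ContinuousOn v Ω) : ∀ x ∈ Ω, u x ≤ v x := by
  by_contra! hcon
  obtain ⟨x, hx, hlt⟩ := hcon
  have hev : ∀ᶠ y in nhds x, v y < u y :=
    (hv.continuousAt (hΩ.mem_nhds hx)).eventually_lt (hu.continuousAt (hΩ.mem_nhds hx)) hlt
  refine (Measure.measure_pos_of_mem_nhds volume hev).ne' (measure_mono_null ?_ (ae_iff.1 h))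
  exact fun y hy => not_le.2 hy

end FracSing

theorem mainTheorem9 {N : ℕ} (hN : 2 ≤ N) (Ω : Set (EuclideanSpace ℝ (Fin N)))
    (hΩ : FracSing.IsBoundedSmoothDomain Ω)
    (s p α : ℝ) (hs0 : 0 < s) (hs1 : s < 1) (hp : 1 < p) (hα : 0 < α)
    (ω : EuclideanSpace ℝ (Fin N) → ℝ)
    (hω_int : IntegrableOn ω Ω volume)
    (hω_nonneg : ∀ᵐ x ∂(volume.restrict Ω), 0 ≤ ω x)
    (hω_ne : ¬ ∀ᵐ x ∂(volume.restrict Ω), ω x = 0)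
    (u : ℕ → EuclideanSpace ℝ (Fin N) → ℝ)
    (hu : ∀ n : ℕ, 1 ≤ n → FracSing.IsWeakSolution Ω s p α ω n (u n)) :
    ∀ n : ℕ, 1 ≤ n →
      (∀ᵐ x ∂(volume.restrict Ω), u n x ≤ u (n + 1) x) ∧
      (ContinuousOn (u n) Ω → ContinuousOn (u (n + 1)) Ω → ∀ x ∈ Ω, u n x ≤ u (n + 1) x) ∧
      0 < FracSing.gagliardo s p (u n) ∧
      FracSing.gagliardo s p (u n) < ⊤ ∧
      FracSing.gagliardo s p (u n) ≤ FracSing.gagliardo s p (u (n + 1)) := by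
  intro n hn
  have hn' : 1 ≤ n + 1 := hn.trans n.le_succ
  have hle := (hu n hn).ae_le hN hΩ.isBounded hp hα hn n.le_succ hω_int hω_nonneg (hu (n + 1) hn')
  exact ⟨ae_restrict_of_ae hle, FracSing.le_of_ae_le_of_continuousOn hΩ.isOpen hle,
    (hu n hn).gagliardo_pos hN hp hΩ, (hu n hn).memW0.gagliardo_lt_top,
    (hu n hn).gagliardo_le hp hΩ.isBounded hα hn hω_int hω_nonneg (hu (n + 1) hn').memW0
      (ae_restrict_of_ae hle)⟩
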